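/- Let $G=(V,E)$ be a finite, simple, connected, undirected graph with symmetric edge weights $\omega_{ij}\ge 0$ (with $\omega_{ij}=0$ if $ij\notin E$) and positive degrees $d_i=\sum_j\omega_{ij}>0$. Let $r\in[0,1]$ and $\varepsilon>0$. For $u,v:V\to\mathbb R$ write $\langle u,v\rangle=\sum_i u_iv_id_i^r$, $\|u\|=\langle u,u\rangle^{1/2}$, $\bar u=\langle u,\mathbf 1\rangle/\langle\mathbf 1,\mathbf 1\rangle$, $(\Delta u)_i=d_i^{-r}\sum_j\omega_{ij}(u_i-u_j)$, and $\|\Delta\|=\sup_{\|u\|=1}\|\Delta u\|$. For $u:V\to[0,1]$ let $\mathcal B(u)$ be the set of $\beta:V\to\mathbb R$ with $\beta_i\ge0$ if $u_i=0$, $\beta_i=0$ if $0<u_i<1$, $\beta_i\le 0$ if $u_i=1$ (and $\mathcal B(u)=\emptyset$ if $u$ is not $[0,1]$-valued). Let $u_0:V\to[0,1]$. For $0<\tau<\varepsilon$ and $\lambda=\tau/\varepsilon$, semi-discrete iterates $(u^{[\tau]}_m,\beta^{[\tau]}_m)$ with initial state $u^{[\tau]}_0=u_0$ are defined by $$u_{m+1}-e^{-\tau\Delta}u_m-\lambda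 u_{m+1}+\lambda\overline{u_{m+1}}\mathbf 1=\lambda\beta_{m+1}-\lambda\overline{\beta_{m+1}}\mathbf 1,\qquad \beta_{m+1}\in\mathcal B(u_{m+1}).$$ For a sequence $\tau_n\to0$ with $0<\tau_n<\varepsilon$, a function $\hat u:[0,\infty)\to\mathbb R^V$ is called a semi-discrete limit along $(\tau_n)$ if, for such iterates, $\hat u(t)=\lim_{n\to\infty}u^{[\tau_n]}_{\lceil t/\tau_n\rceil}$ for every $t\ge0$ (this is the mass-conserving double-obstacle Allen--Cahn trajectory started at $u_0$). Then every sequence of positive time steps tending to $0$ has a subsequence along which a semi-discrete limit exists, and every semi-discrete limit $\hat u$ is Lipschitz continuous in time, $\hat u\in C^{0,1}([0,\infty);\mathcal V)$, where $\mathcal V=\mathbb R^V$ with norm $\|\cdot\|$. Explicitly, for all $s,t\ge0$, $$\|\hat u(t)-\hat u(s)\|\le \max\{\bar u,1-\bar u\}\,\|\mathbf 1\|\left(\max\left\{e^{1/\varepsilon}-1,\ \|\Delta\|-\tfrac1\varepsilon\right\}+\tfrac1\varepsilon e^{1/\varepsilon}\right)|t-s|,$$ where $\bar u=\overline{u_0}$,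 and moreover $\|\hat u(t)-\hat u(s)\|\le\|\mathbf 1\|\,|t-s|$ whenever $|t-s|\ge1$. -/

import Mathlib

open Set Filter Topology

/-- A finite, simple, connected, undirected graph with non-negative edge weights, extended by zero
off the edges, all of whose (weighted) degrees are positive. -/
structure WeightedGraph (V : Type*) [Fintype V] where
  graph : SimpleGraph V
  connected : graph.Connected
  weight : V → V → ℝ
  weight_symm : ∀ i j, weight i j = weight j i
  weight_nonneg : ∀ i j, 0 ≤ weight i j
  weight_eq_zero : ∀ i j, ¬ graph.Adj i j → weight i j = 0
  degree_pos : ∀ i, 0 < ∑ j, weight i j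

noncomputable section

namespace WeightedGraph

variable {V : Type*} [Fintype V]

/-- The degree `d_i = ∑_j ω_ij`. -/
def degree (G : WeightedGraph V) (i : V) : ℝ := ∑ j, G.weight i j

/-- The inner product `⟨u, v⟩_V = ∑_i u_i v_i d_i ^ r`. -/
def innerV (G : WeightedGraph V) (r : ℝ) (u v : V → ℝ) : ℝ :=
  ∑ i, u i * v i * G.degree i ^ r

/-- The norm `‖u‖_V` induced by `⟨·, ·⟩_V`. -/
def normV (G : WeightedGraph V) (r : ℝ) (u : V → ℝ) : ℝ :=
  Real.sqrt (G.innerV r u u)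

/-- The operator norm `‖F‖ = sup { ‖F u‖_V : ‖u‖_V = 1 }`. -/
def opNorm (G : WeightedGraph V) (r : ℝ) (F : (V → ℝ) → (V → ℝ)) : ℝ :=
  sSup {x | ∃ u : V → ℝ, G.normV r u = 1 ∧ x = G.normV r (F u)}

/-- The mass `⟨u, 1⟩_V`. -/
def mass (G : WeightedGraph V) (r : ℝ) (u : V → ℝ) : ℝ := G.innerV r u 1

/-- The average value `⟨u, 1⟩_V / ⟨1, 1⟩_V`. -/
def average (G : WeightedGraph V) (r : ℝ) (u : V → ℝ) : ℝ := G.mass r u / G.mass r 1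

/-- The graph Laplacian `(Δ u)_i = d_i ^ (-r) ∑_j ω_ij (u_i - u_j)`, as a (continuous) linear
map on `V → ℝ`. -/
def laplacian (G : WeightedGraph V) (r : ℝ) : (V → ℝ) →L[ℝ] (V → ℝ) :=
  LinearMap.toContinuousLinearMap
    { toFun := fun u i => G.degree i ^ (-r) * ∑ j, G.weight i j * (u i - u j)
      map_add' := by
        intro u v
        ext i
        simp only [Pi.add_apply, ← mul_add, ← Finset.sum_add_distrib]
        congr 1
        exact Finset.sum_congr rfl fun j _ => by ring
      map_smul' := by
        intro c u
        ext i
        simp only [Pi.smul_apply, smul_eq_mul, RingHom.id_apply, Finset.mul_sum]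
        exact Finset.sum_congr rfl fun j _ => by ring }

/-- The graph diffusion operator `e^{-tΔ} = ∑_n (-t)^n / n! Δ^n`. -/
def diffusion (G : WeightedGraph V) (r t : ℝ) : (V → ℝ) →L[ℝ] (V → ℝ) :=
  NormedSpace.exp ((-t) • G.laplacian r)

end WeightedGraph

/-- The set `B(u)`: the `α` with `α_i ∈ -∂I_{[0,1]}(u_i)` for every vertex `i`. It is empty unless
`u` takes values in `[0, 1]`. -/
def obstacleSet {V : Type*} (u : V → ℝ) : Set (V → ℝ) :=
  {α | ∀ i, u i ∈ Icc (0 : ℝ) 1 ∧ (u i = 0 → 0 ≤ α i) ∧ (0 < u i → u i < 1 → α i = 0) ∧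
    (u i = 1 → α i ≤ 0)}

namespace WeightedGraph

variable {V : Type*} [Fintype V]

/-- `(u_m, β_m)` are iterates of the mass-conserving semi-discrete scheme with time step `τ` and
initial state `u₀`, where `lam = τ / ε`:
`u_{m+1} - e^{-τΔ} u_m - lam u_{m+1} + lam avg(u_{m+1}) 1 = lam β_{m+1} - lam avg(β_{m+1}) 1`
with `β_{m+1} ∈ B(u_{m+1})`. (The value `β 0` plays no role.) -/
def IsSemiDiscrete (G : WeightedGraph V) (r ε τ : ℝ) (u₀ : V → ℝ) (u β : ℕ → V → ℝ) : Prop :=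
  u 0 = u₀ ∧ ∀ m, β (m + 1) ∈ obstacleSet (u (m + 1)) ∧
    u (m + 1) - G.diffusion r τ (u m) - (τ / ε) • u (m + 1)
        + ((τ / ε) * G.average r (u (m + 1))) • (1 : V → ℝ)
      = (τ / ε) • β (m + 1) - ((τ / ε) * G.average r (β (m + 1))) • (1 : V → ℝ)

/-- `uhat` is the semi-discrete limit along the time steps `τ_n → 0`, `0 < τ_n < ε`: for every
`t ≥ 0`, `uhat t = lim_n u^{[τ_n]}_m` with `m = ⌈t / τ_n⌉`, where `u^{[τ_n]}` are semi-discrete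
iterates with time step `τ_n` and initial state `u₀`. -/
def IsSemiDiscreteLimit (G : WeightedGraph V) (r ε : ℝ) (u₀ : V → ℝ) (τ : ℕ → ℝ)
    (uhat : ℝ → V → ℝ) : Prop :=
  (∀ n, 0 < τ n ∧ τ n < ε) ∧ Tendsto τ atTop (𝓝 0) ∧
    ∃ u β : ℕ → ℕ → V → ℝ, (∀ n, G.IsSemiDiscrete r ε (τ n) u₀ (u n) (β n)) ∧
      ∀ t : ℝ, 0 ≤ t → Tendsto (fun n => u n ⌈t / τ n⌉₊) atTop (𝓝 (uhat t))

/-- `max(avg, 1 - avg) ‖1‖_V (max(e^{1/ε} - 1, ‖Δ‖ - 1/ε) + e^{1/ε}/ε)`, where `avg` is the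
average value of `u₀`. -/
def lipschitzConstant (G : WeightedGraph V) (r ε : ℝ) (u₀ : V → ℝ) : ℝ :=
  max (G.average r u₀) (1 - G.average r u₀) * G.normV r 1 *
    (max (Real.exp (1 / ε) - 1) (G.opNorm r (G.laplacian r) - 1 / ε) + 1 / ε * Real.exp (1 / ε))

end WeightedGraph

end

/-! Write `M` for the conserved average and `l = τ/ε`. Averaging the scheme shows that mass is
preserved, so one step reads `(1 - l) u_{m+1} = e^{-τΔ} u_m + l (β - avg β - M)`. Subtracting `(1 -
l) u_m` gives `(1 - l)(u_{m+1} - u_m) = R u_m + τ (1/ε - Δ) v + l d`, where `R = e^{-τΔ} - 1 + τΔ`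
is `o(τ)`, `v = u_m - M` and `d = β - avg β`. Both `v` and `d` are bounded pointwise by `max M (1 -
M)`. For `v` this is clear from `0 ≤ u_m ≤ 1`; for `d` it is the main estimate,
`IsStep.abs_sub_average_le`. Since `Δ` is self-adjoint and nonnegative, `1/ε - Δ` has norm at most
`max (1/ε) (‖Δ‖ - 1/ε)` (`normV_smul_sub_laplacian_le`). Hence the discrete speed is at most
`speedBound + o(1)`, and `speedBound` does not exceed the stated constant. This bound passes to
pointwise limits. It also makes the interpolants asymptotically equi-Lipschitz, so an Arzelà–Ascoli
argument gives convergent subsequences. The estimate for `|t - s| ≥ 1` only uses that limits take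
values in `[0, 1]`. -/

section
-- Exponentials of bounded operators.
variable {E : Type*} [NormedAddCommGroup E] [NormedSpace ℝ E] [CompleteSpace E]

theorem ContinuousLinearMap.hasSum_exp_apply (A : E →L[ℝ] E) (x : E) :
    HasSum (fun n : ℕ => (n.factorial : ℝ)⁻¹ • (A ^ n) x) (NormedSpace.exp A x) := by
  simpa using (ContinuousLinearMap.apply ℝ E x).hasSum (NormedSpace.exp_series_hasSum_exp' (𝕂 := ℝ) A)

theorem ContinuousLinearMap.exp_apply_of_apply_eq_zero {A : E →L[ℝ] E} {x : E} (h : A x = 0) :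
    NormedSpace.exp A x = x := by
  refine (A.hasSum_exp_apply x).unique ?_
  convert hasSum_single (α := E) 0 fun n hn => ?_ using 1
  · simp
  · obtain ⟨k, rfl⟩ := Nat.exists_eq_succ_of_ne_zero hn
    simp [pow_succ, h]

/-- Every term of the exponential series beyond the zeroth lies in the range of `A`, which `f`
kills. With `f` the mass this is conservation of mass under diffusion. -/
theorem ContinuousLinearMap.apply_exp_of_comp_eq_zero {A : E →L[ℝ] E} {f : E →L[ℝ] ℝ}
    (h : ∀ x, f (A x) = 0) (x : E) : f (NormedSpace.exp A x) = f x := by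
  refine (f.hasSum (A.hasSum_exp_apply x)).unique ?_
  convert hasSum_single (α := ℝ) 0 fun n hn => ?_ using 1
  · simp
  · obtain ⟨k, rfl⟩ := Nat.exists_eq_succ_of_ne_zero hn
    simp [pow_succ', h]

end

theorem ContinuousLinearMap.exp_apply_nonneg {V : Type*} [Fintype V] {A : (V → ℝ) →L[ℝ] (V → ℝ)}
    (h : ∀ u, 0 ≤ u → 0 ≤ A u) {u : V → ℝ} (hu : 0 ≤ u) : 0 ≤ NormedSpace.exp A u := by
  refine (A.hasSum_exp_apply u).nonneg fun n => ?_
  have : 0 ≤ (A ^ n) u := by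
    induction n with
    | zero => simpa using hu
    | succ n ih => rw [pow_succ']; exact h _ ih
  exact smul_nonneg (by positivity) this

theorem ContinuousLinearMap.exp_sub_smul_one {V : Type*} [Fintype V]
    (A : (V → ℝ) →L[ℝ] (V → ℝ)) (c : ℝ) :
    NormedSpace.exp (A - c • 1) = Real.exp (-c) • NormedSpace.exp A := by
  let _ : NormedAlgebra ℚ ((V → ℝ) →L[ℝ] (V → ℝ)) := NormedAlgebra.restrictScalars ℚ ℝ _
  have h : NormedSpace.exp (algebraMap ℝ ((V → ℝ) →L[ℝ] (V → ℝ)) (-c))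
      = algebraMap ℝ _ (Real.exp (-c)) := by
    rw [Real.exp_eq_exp_ℝ, NormedSpace.algebraMap_exp_comm]
  have h' : A - c • 1 = algebraMap ℝ ((V → ℝ) →L[ℝ] (V → ℝ)) (-c) + A := by
    ext u i
    simp [Algebra.algebraMap_eq_smul_one]
    ring
  rw [h', NormedSpace.exp_add_of_commute (Algebra.commutes _ _), h, Algebra.smul_def]

/-! ### The weighted inner product, its norm and the operator norm. -/

namespace WeightedGraph

variable {V : Type*} [Fintype V] (G : WeightedGraph V) (r : ℝ)

theorem degree_rpow_pos (i : V) : 0 < G.degree i ^ r :=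
  Real.rpow_pos_of_pos (G.degree_pos i) r

theorem innerV_comm (u v : V → ℝ) : G.innerV r u v = G.innerV r v u :=
  Finset.sum_congr rfl fun i _ => by ring

theorem innerV_add_left (u v w : V → ℝ) :
    G.innerV r (u + v) w = G.innerV r u w + G.innerV r v w := by
  simp only [innerV, ← Finset.sum_add_distrib, Pi.add_apply]
  exact Finset.sum_congr rfl fun i _ => by ring

theorem innerV_smul_left (c : ℝ) (u v : V → ℝ) :
    G.innerV r (c • u) v = c * G.innerV r u v := by
  simp only [innerV, Finset.mul_sum, Pi.smul_apply, smul_eq_mul]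
  exact Finset.sum_congr rfl fun i _ => by ring

theorem innerV_add_right (u v w : V → ℝ) :
    G.innerV r u (v + w) = G.innerV r u v + G.innerV r u w := by
  rw [innerV_comm, innerV_add_left, innerV_comm, G.innerV_comm r w]

theorem innerV_smul_right (c : ℝ) (u v : V → ℝ) :
    G.innerV r u (c • v) = c * G.innerV r u v := by
  rw [innerV_comm, innerV_smul_left, innerV_comm]

theorem innerV_self_nonneg (u : V → ℝ) : 0 ≤ G.innerV r u u :=
  Finset.sum_nonneg fun i _ => mul_nonneg (mul_self_nonneg _) (G.degree_rpow_pos r i).le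

theorem normV_nonneg (u : V → ℝ) : 0 ≤ G.normV r u := Real.sqrt_nonneg _

theorem normV_sq (u : V → ℝ) : G.normV r u ^ 2 = G.innerV r u u :=
  Real.sq_sqrt (G.innerV_self_nonneg r u)

/-- Rescaling coordinates by `√(d_i ^ r)` is an isometry into Euclidean space, from which the
triangle inequality is inherited. -/
theorem normV_eq_norm (u : V → ℝ) :
    G.normV r u = ‖WithLp.toLp 2 (fun i => √(G.degree i ^ r) * u i)‖ := by
  rw [EuclideanSpace.norm_eq, normV, innerV]
  congr 1
  refine Finset.sum_congr rfl fun i _ => ?_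
  rw [Real.norm_eq_abs, sq_abs, mul_pow, Real.sq_sqrt (G.degree_rpow_pos r i).le]
  ring

theorem normV_add_le (u v : V → ℝ) : G.normV r (u + v) ≤ G.normV r u + G.normV r v := by
  rw [normV_eq_norm, normV_eq_norm, normV_eq_norm]
  refine le_trans (le_of_eq ?_) (norm_add_le _ _)
  rw [← WithLp.toLp_add]
  congr 2
  ext i
  simp [mul_add]

theorem normV_smul (c : ℝ) (u : V → ℝ) : G.normV r (c • u) = |c| * G.normV r u := by
  rw [normV, innerV_smul_left, innerV_smul_right, ← mul_assoc, Real.sqrt_mul (mul_self_nonneg c),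
    Real.sqrt_mul_self_eq_abs, normV]

theorem normV_zero : G.normV r 0 = 0 := by simp [normV, innerV]

theorem normV_neg (u : V → ℝ) : G.normV r (-u) = G.normV r u := by
  simpa using G.normV_smul r (-1) u

theorem normV_sub_comm (u v : V → ℝ) : G.normV r (u - v) = G.normV r (v - u) := by
  rw [← neg_sub, normV_neg]

theorem normV_le_of_abs_le {u v : V → ℝ} (h : ∀ i, |u i| ≤ |v i|) :
    G.normV r u ≤ G.normV r v := by
  refine Real.sqrt_le_sqrt (Finset.sum_le_sum fun i _ => ?_)
  exact mul_le_mul_of_nonneg_right (abs_le_iff_mul_self_le.mp (h i)) (G.degree_rpow_pos r i).le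

theorem normV_le_of_forall_abs_le {u : V → ℝ} {c : ℝ} (hc : 0 ≤ c) (h : ∀ i, |u i| ≤ c) :
    G.normV r u ≤ c * G.normV r 1 := by
  rw [← abs_of_nonneg hc, ← normV_smul]
  exact G.normV_le_of_abs_le r fun i => by simpa [abs_of_nonneg hc] using h i

theorem normV_le_norm (u : V → ℝ) : G.normV r u ≤ ‖u‖ * G.normV r 1 :=
  G.normV_le_of_forall_abs_le r (norm_nonneg _) fun i => norm_le_pi_norm u i

theorem continuous_normV : Continuous (G.normV r) := by
  unfold normV innerV
  fun_prop

theorem sqrt_mul_abs_le_normV (u : V → ℝ) (i : V) :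
    √(G.degree i ^ r) * |u i| ≤ G.normV r u := by
  rw [normV_eq_norm]
  refine le_trans (le_of_eq ?_) (PiLp.norm_apply_le _ i)
  rw [Real.norm_eq_abs, abs_mul, abs_of_nonneg (Real.sqrt_nonneg _)]

theorem sqrt_degree_rpow_pos (i : V) : 0 < √(G.degree i ^ r) :=
  Real.sqrt_pos.mpr (G.degree_rpow_pos r i)

theorem eq_zero_of_normV_eq_zero {u : V → ℝ} (h : G.normV r u = 0) : u = 0 := by
  ext i
  have := G.sqrt_mul_abs_le_normV r u i
  rw [h] at this
  have := nonpos_of_mul_nonpos_right this (G.sqrt_degree_rpow_pos r i)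
  simpa using this

theorem norm_le_normV : ∃ C, ∀ u : V → ℝ, ‖u‖ ≤ C * G.normV r u := by
  refine ⟨∑ i, (√(G.degree i ^ r))⁻¹, fun u => ?_⟩
  have hC : 0 ≤ ∑ i, (√(G.degree i ^ r))⁻¹ := Finset.sum_nonneg fun i _ => by positivity
  refine (pi_norm_le_iff_of_nonneg (mul_nonneg hC (G.normV_nonneg r u))).mpr fun i => ?_
  calc ‖u i‖ ≤ (√(G.degree i ^ r))⁻¹ * G.normV r u := by
        rw [inv_mul_eq_div, le_div_iff₀ (G.sqrt_degree_rpow_pos r i), mul_comm]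
        exact G.sqrt_mul_abs_le_normV r u i
    _ ≤ _ := mul_le_mul_of_nonneg_right
        (Finset.single_le_sum (f := fun i => (√(G.degree i ^ r))⁻¹)
          (fun j _ => by positivity) (Finset.mem_univ i)) (G.normV_nonneg r u)

/-- Without boundedness the real supremum in `opNorm` would default to `0` and bound nothing. -/
theorem bddAbove_opNorm (F : (V → ℝ) →L[ℝ] (V → ℝ)) :
    BddAbove {x | ∃ u : V → ℝ, G.normV r u = 1 ∧ x = G.normV r (F u)} := by
  obtain ⟨C, hC⟩ := G.norm_le_normV r
  refine ⟨‖F‖ * C * G.normV r 1, ?_⟩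
  rintro _ ⟨u, hu, rfl⟩
  refine (G.normV_le_norm r _).trans (mul_le_mul_of_nonneg_right ?_ (G.normV_nonneg r 1))
  refine (F.le_opNorm u).trans (mul_le_mul_of_nonneg_left ?_ (norm_nonneg _))
  simpa [hu] using hC u

theorem opNorm_nonneg (F : (V → ℝ) → (V → ℝ)) : 0 ≤ G.opNorm r F := by
  refine Real.sSup_nonneg ?_
  rintro _ ⟨u, -, rfl⟩
  exact G.normV_nonneg r _

theorem normV_apply_le_opNorm (F : (V → ℝ) →L[ℝ] (V → ℝ)) (u : V → ℝ) :
    G.normV r (F u) ≤ G.opNorm r F * G.normV r u := by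
  rcases (G.normV_nonneg r u).eq_or_lt with h | h
  · rw [G.eq_zero_of_normV_eq_zero r h.symm]
    simp [normV_zero]
  · have := le_csSup (G.bddAbove_opNorm r F)
      ⟨(G.normV r u)⁻¹ • u, by rw [normV_smul, abs_of_pos (inv_pos.mpr h), inv_mul_cancel₀ h.ne'],
        rfl⟩
    rw [map_smul, normV_smul, abs_of_pos (inv_pos.mpr h), inv_mul_le_iff₀ h] at this
    rwa [mul_comm]

theorem innerV_sq_le (u v : V → ℝ) : G.innerV r u v ^ 2 ≤ G.innerV r u u * G.innerV r v v := by
  have := discrim_le_zero (a := G.innerV r v v) (b := 2 * G.innerV r u v) (c := G.innerV r u u)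
    fun t => by
      have := G.innerV_self_nonneg r (u + t • v)
      simp only [innerV_add_left, innerV_add_right, innerV_smul_left, innerV_smul_right] at this
      rw [G.innerV_comm r v u] at this
      linarith
  rw [discrim] at this
  linarith

theorem innerV_le (u v : V → ℝ) : G.innerV r u v ≤ G.normV r u * G.normV r v := by
  refine le_of_abs_le <| abs_le_of_sq_le_sq ?_ (mul_nonneg (G.normV_nonneg r u) (G.normV_nonneg r v))
  rw [mul_pow, normV_sq, normV_sq]
  exact G.innerV_sq_le r u v

/-! ### The Laplacian as a symmetric nonnegative form. -/

theorem laplacian_apply (u : V → ℝ) (i : V) :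
    G.laplacian r u i = G.degree i ^ (-r) * ∑ j, G.weight i j * (u i - u j) := rfl

/-- Summation by parts: swapping `i` and `j` with symmetric weights and averaging the two
expressions. Symmetry, nonnegativity and zero mass of `Δu` all follow from this form. -/
theorem innerV_laplacian (u v : V → ℝ) :
    G.innerV r (G.laplacian r u) v
      = (∑ i, ∑ j, G.weight i j * (u i - u j) * (v i - v j)) / 2 := by
  have h : G.innerV r (G.laplacian r u) v = ∑ i, ∑ j, G.weight i j * (u i - u j) * v i := by
    refine Finset.sum_congr rfl fun i _ => ?_
    have hd : G.degree i ^ (-r) = (G.degree i ^ r)⁻¹ := Real.rpow_neg (G.degree_pos i).le r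
    rw [laplacian_apply, ← Finset.sum_mul, hd]
    field_simp [(G.degree_rpow_pos r i).ne']
  have h' : G.innerV r (G.laplacian r u) v = ∑ i, ∑ j, -(G.weight i j * (u i - u j) * v j) := by
    rw [h, Finset.sum_comm]
    refine Finset.sum_congr rfl fun i _ => Finset.sum_congr rfl fun j _ => ?_
    rw [G.weight_symm i j]
    ring
  have : G.innerV r (G.laplacian r u) v + G.innerV r (G.laplacian r u) v
      = ∑ i, ∑ j, G.weight i j * (u i - u j) * (v i - v j) := by
    nth_rewrite 1 [h]
    rw [h']
    simp only [← Finset.sum_add_distrib]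
    refine Finset.sum_congr rfl fun i _ => Finset.sum_congr rfl fun j _ => ?_
    ring
  linarith

theorem innerV_laplacian_comm (u v : V → ℝ) :
    G.innerV r (G.laplacian r u) v = G.innerV r (G.laplacian r v) u := by
  rw [innerV_laplacian, innerV_laplacian]
  congr 1
  refine Finset.sum_congr rfl fun i _ => Finset.sum_congr rfl fun j _ => by ring

theorem innerV_laplacian_self_nonneg (u : V → ℝ) : 0 ≤ G.innerV r (G.laplacian r u) u := by
  rw [innerV_laplacian]
  refine div_nonneg (Finset.sum_nonneg fun i _ => Finset.sum_nonneg fun j _ => ?_) zero_le_two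
  rw [mul_assoc]
  exact mul_nonneg (G.weight_nonneg i j) (mul_self_nonneg _)

theorem innerV_laplacian_sq_le (u v : V → ℝ) :
    G.innerV r (G.laplacian r u) v ^ 2
      ≤ G.innerV r (G.laplacian r u) u * G.innerV r (G.laplacian r v) v := by
  have := discrim_le_zero (a := G.innerV r (G.laplacian r v) v)
    (b := 2 * G.innerV r (G.laplacian r u) v) (c := G.innerV r (G.laplacian r u) u)
    fun t => by
      have := G.innerV_laplacian_self_nonneg r (u + t • v)
      simp only [map_add, map_smul, innerV_add_left, innerV_add_right, innerV_smul_left,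
        innerV_smul_right] at this
      rw [G.innerV_laplacian_comm r v u] at this
      linarith
  rw [discrim] at this
  linarith

theorem innerV_laplacian_self_le (u : V → ℝ) :
    G.innerV r (G.laplacian r u) u ≤ G.opNorm r (G.laplacian r) * G.normV r u ^ 2 := by
  refine (G.innerV_le r _ _).trans ?_
  rw [sq, ← mul_assoc]
  exact mul_le_mul_of_nonneg_right (G.normV_apply_le_opNorm r _ u) (G.normV_nonneg r u)

/-- Cauchy–Schwarz for the semidefinite form `⟨Δ·, ·⟩`, applied to `u` and `Δu`, replaces the
spectral theorem here; one factor `‖Δu‖²` is then cancelled. -/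
theorem normV_laplacian_sq_le (u : V → ℝ) :
    G.normV r (G.laplacian r u) ^ 2
      ≤ G.opNorm r (G.laplacian r) * G.innerV r (G.laplacian r u) u := by
  rcases (sq_nonneg (G.normV r (G.laplacian r u))).eq_or_lt with h | h
  · rw [← h]
    exact mul_nonneg (G.opNorm_nonneg r _) (G.innerV_laplacian_self_nonneg r u)
  · have h1 := G.innerV_laplacian_sq_le r u (G.laplacian r u)
    rw [← normV_sq] at h1
    have h2 := mul_le_mul_of_nonneg_left (G.innerV_laplacian_self_le r (G.laplacian r u))
      (G.innerV_laplacian_self_nonneg r u)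
    refine le_of_mul_le_mul_right ?_ h
    linarith

/-- The operator `a - Δ` with `a ≥ 0` has norm at most `max a (‖Δ‖ - a)`. -/
theorem normV_smul_sub_laplacian_le {a : ℝ} (ha : 0 ≤ a) (v : V → ℝ) :
    G.normV r (a • v - G.laplacian r v)
      ≤ max a (G.opNorm r (G.laplacian r) - a) * G.normV r v := by
  have h0 : 0 ≤ max a (G.opNorm r (G.laplacian r) - a) := le_max_of_le_left ha
  refine le_of_abs_le <| abs_le_of_sq_le_sq ?_ (mul_nonneg h0 (G.normV_nonneg r v))
  have h1 := G.normV_laplacian_sq_le r v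
  have h2 := G.innerV_laplacian_self_le r v
  have h3 := G.innerV_laplacian_self_nonneg r v
  have h4 : G.normV r (a • v - G.laplacian r v) ^ 2 = a ^ 2 * G.normV r v ^ 2
      - 2 * a * G.innerV r (G.laplacian r v) v + G.normV r (G.laplacian r v) ^ 2 := by
    rw [sub_eq_add_neg, ← neg_one_smul ℝ (G.laplacian r v)]
    simp only [normV_sq, innerV_add_left, innerV_add_right, innerV_smul_left, innerV_smul_right]
    rw [G.innerV_comm r v (G.laplacian r v)]
    ring
  rw [h4, mul_pow]
  set ν := G.opNorm r (G.laplacian r)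
  set q := G.innerV r (G.laplacian r v) v
  -- So far the square is at most `a² ‖v‖² + (ν - 2a) q` with `0 ≤ q ≤ ν ‖v‖²`. The sign of `ν - 2a`
  -- decides which end of the range of `q` is worst; at the upper end, `a² + (ν - 2a) ν = (ν - a)²`.
  rcases le_total ν (2 * a) with h | h
  · rw [max_eq_left (by linarith)]
    nlinarith [mul_nonneg (sub_nonneg.mpr h) h3]
  · rw [max_eq_right (by linarith)]
    nlinarith [mul_le_mul_of_nonneg_left h2 (sub_nonneg.mpr h)]

theorem mass_laplacian (u : V → ℝ) : G.mass r (G.laplacian r u) = 0 := by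
  simp [mass, innerV_laplacian]

theorem laplacian_one : G.laplacian r 1 = 0 := by
  ext i
  simp [laplacian_apply]

end WeightedGraph

/-! ### Diffusion preserves order, constants and mass; properties of averages. -/

namespace WeightedGraph

variable {V : Type*} [Fintype V] (G : WeightedGraph V) (r : ℝ)

/-- The off-diagonal entries of `-Δ` are nonnegative, and the scalar, being the sum of the
nonnegative numbers `d_i ^ (-r) d_i`, dominates each diagonal entry of `Δ`. -/
theorem smul_sub_laplacian_nonneg {u : V → ℝ} (hu : 0 ≤ u) :
    0 ≤ (∑ i, G.degree i ^ (-r) * G.degree i) • u - G.laplacian r u := by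
  intro i
  have hd : ∀ j, 0 ≤ G.degree j ^ (-r) := fun j => (G.degree_rpow_pos (-r) j).le
  have h1 : G.degree i ^ (-r) * G.degree i ≤ ∑ i, G.degree i ^ (-r) * G.degree i :=
    Finset.single_le_sum (f := fun i => G.degree i ^ (-r) * G.degree i)
      (fun j _ => mul_nonneg (hd j) (G.degree_pos j).le) (Finset.mem_univ i)
  have h2 : G.laplacian r u i = G.degree i ^ (-r) * G.degree i * u i
      - G.degree i ^ (-r) * ∑ j, G.weight i j * u j := by
    rw [laplacian_apply, degree]
    simp only [mul_sub, Finset.sum_sub_distrib, ← Finset.sum_mul]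
    ring
  have h3 : 0 ≤ G.degree i ^ (-r) * ∑ j, G.weight i j * u j :=
    mul_nonneg (hd i) (Finset.sum_nonneg fun j _ => mul_nonneg (G.weight_nonneg i j) (hu j))
  have h4 := mul_le_mul_of_nonneg_right h1 (hu i)
  simp only [Pi.sub_apply, Pi.smul_apply, smul_eq_mul, h2, Pi.zero_apply]
  linarith

theorem diffusion_nonneg {t : ℝ} (ht : 0 ≤ t) {u : V → ℝ} (hu : 0 ≤ u) :
    0 ≤ G.diffusion r t u := by
  set s := ∑ i, G.degree i ^ (-r) * G.degree i
  -- Shifting by a scalar makes the exponent entrywise nonnegative, at the cost of a positive factor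
  -- `e^{-ts}`.
  have h : (-t) • G.laplacian r = t • (s • 1 - G.laplacian r) - (t * s) • 1 := by
    ext u i
    simp
    ring
  rw [diffusion, h, ContinuousLinearMap.exp_sub_smul_one]
  refine smul_nonneg (Real.exp_pos _).le (ContinuousLinearMap.exp_apply_nonneg ?_ hu)
  intro v hv
  exact smul_nonneg ht (G.smul_sub_laplacian_nonneg r hv)

theorem diffusion_one (t : ℝ) : G.diffusion r t 1 = 1 :=
  ContinuousLinearMap.exp_apply_of_apply_eq_zero (by simp [laplacian_one])

theorem diffusion_mem_Icc {t : ℝ} (ht : 0 ≤ t) {u : V → ℝ} (hu : ∀ i, u i ∈ Icc (0 : ℝ) 1) (i : V) :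
    G.diffusion r t u i ∈ Icc (0 : ℝ) 1 := by
  refine ⟨G.diffusion_nonneg r ht (fun j => (hu j).1) i, ?_⟩
  have := G.diffusion_nonneg r ht (u := 1 - u) (fun j => by simpa using (hu j).2) i
  rw [map_sub, diffusion_one] at this
  simpa using this

theorem mass_diffusion (t : ℝ) (u : V → ℝ) : G.mass r (G.diffusion r t u) = G.mass r u := by
  let f : (V → ℝ) →L[ℝ] ℝ := LinearMap.toContinuousLinearMap
    { toFun := G.mass r
      map_add' := fun u v => G.innerV_add_left r u v 1
      map_smul' := fun c u => G.innerV_smul_left r c u 1 }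
  refine ContinuousLinearMap.apply_exp_of_comp_eq_zero (f := f) (fun x => ?_) u
  rw [_root_.smul_apply, map_smul]
  exact smul_eq_zero_of_right _ (G.mass_laplacian r x)

theorem average_diffusion (t : ℝ) (u : V → ℝ) :
    G.average r (G.diffusion r t u) = G.average r u := by
  rw [average, mass_diffusion, average]

theorem mass_one_pos : 0 < G.mass r 1 := by
  obtain ⟨i⟩ := G.connected.nonempty
  refine Finset.sum_pos (fun j _ => ?_) ⟨i, Finset.mem_univ i⟩
  simpa using G.degree_rpow_pos r j

theorem average_add (u v : V → ℝ) : G.average r (u + v) = G.average r u + G.average r v := by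
  rw [average, mass, innerV_add_left, add_div]
  rfl

theorem average_smul (c : ℝ) (u : V → ℝ) : G.average r (c • u) = c * G.average r u := by
  rw [average, mass, innerV_smul_left, mul_div_assoc]
  rfl

theorem average_sub (u v : V → ℝ) : G.average r (u - v) = G.average r u - G.average r v := by
  have := G.average_add r (u - v) v
  rw [sub_add_cancel] at this
  linarith

theorem average_one : G.average r 1 = 1 := div_self (G.mass_one_pos r).ne'

theorem average_nonneg {u : V → ℝ} (hu : ∀ i, 0 ≤ u i) : 0 ≤ G.average r u := by
  refine div_nonneg (Finset.sum_nonneg fun i _ => ?_) (G.mass_one_pos r).le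
  simpa using mul_nonneg (hu i) (G.degree_rpow_pos r i).le

theorem average_mono {u v : V → ℝ} (h : ∀ i, u i ≤ v i) : G.average r u ≤ G.average r v := by
  have := G.average_nonneg r (u := v - u) fun i => sub_nonneg.mpr (h i)
  rw [average_sub] at this
  linarith

theorem average_mem_Icc {u : V → ℝ} (hu : ∀ i, u i ∈ Icc (0 : ℝ) 1) :
    G.average r u ∈ Icc (0 : ℝ) 1 := by
  refine ⟨G.average_nonneg r fun i => (hu i).1, ?_⟩
  rw [← G.average_one r]
  exact G.average_mono r fun i => (hu i).2

theorem eq_of_le_of_average_eq {u v : V → ℝ} (h : ∀ i, u i ≤ v i)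
    (h' : G.average r u = G.average r v) : u = v := by
  have h0 : G.mass r (v - u) = 0 := by
    have := G.average_sub r v u
    rw [h', sub_self, average, div_eq_zero_iff] at this
    exact this.resolve_right (G.mass_one_pos r).ne'
  have hn : ∀ i ∈ Finset.univ, 0 ≤ (v - u) i * (1 : V → ℝ) i * G.degree i ^ r := fun i _ => by
    simpa using mul_nonneg (sub_nonneg.mpr (h i)) (G.degree_rpow_pos r i).le
  ext i
  have := (Finset.sum_eq_zero_iff_of_nonneg hn).mp h0 i (Finset.mem_univ i)
  simp [(G.degree_rpow_pos r i).ne'] at this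
  linarith

theorem continuous_average : Continuous (G.average r) := by
  unfold average mass innerV
  fun_prop

/-- The state `u` and multiplier `β` solve one step of the scheme with parameter `l`, starting from
the diffused state `w`. -/
structure IsStep (G : WeightedGraph V) (r l : ℝ) (w u β : V → ℝ) : Prop where
  mem : β ∈ obstacleSet u
  eq : u - w - l • u + (l * G.average r u) • (1 : V → ℝ)
    = l • β - (l * G.average r β) • (1 : V → ℝ)

/-! ### One step of the scheme: the multiplier bound and solvability. -/

section Step

variable {G r} {l : ℝ} {w u β : V → ℝ}

theorem IsStep.average_eq (h : G.IsStep r l w u β) : G.average r u = G.average r w := by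
  have := congrArg (G.average r) h.eq
  simp only [average_add, average_sub, average_smul, average_one] at this
  linarith

theorem IsStep.mem_Icc (h : G.IsStep r l w u β) (i : V) : u i ∈ Icc (0 : ℝ) 1 := (h.mem i).1

/-- Conservation of the average collapses all nonlocal terms into one scalar, so the step becomes an
obstacle problem at each vertex, coupled only through that scalar. -/
theorem IsStep.apply (h : G.IsStep r l w u β) (i : V) :
    (1 - l) * u i = w i + l * (β i - (G.average r w + G.average r β)) := by
  have := congrFun h.eq i
  simp only [Pi.add_apply, Pi.sub_apply, Pi.smul_apply, smul_eq_mul, Pi.one_apply,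
    h.average_eq] at this
  linarith

theorem IsStep.cases (h : G.IsStep r l w u β) (i : V) :
    (u i = 0 ∧ 0 ≤ β i) ∨ (0 < u i ∧ u i < 1 ∧ β i = 0) ∨ (u i = 1 ∧ β i ≤ 0) := by
  obtain ⟨hu, h0, h1, h2⟩ := h.mem i
  rcases hu.1.eq_or_lt with h3 | h3
  · exact Or.inl ⟨h3.symm, h0 h3.symm⟩
  rcases hu.2.eq_or_lt with h4 | h4
  · exact Or.inr (Or.inr ⟨h4, h2 h4⟩)
  · exact Or.inr (Or.inl ⟨h3, h4, h1 h3 h4⟩)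

theorem IsStep.eq_average_of_forall_eq (_ : G.IsStep r l w u β) {b : ℝ} (hb : ∀ i, β i = b)
    (i : V) : β i = G.average r β := by
  have : β = b • (1 : V → ℝ) := by
    ext j
    simp [hb j]
  rw [hb i, this, average_smul, average_one, mul_one]

/-- The multiplier deviates from its average by at most `max M (1 - M)`, where `M` is the
conserved average of the state. -/
theorem IsStep.abs_sub_average_le (h : G.IsStep r l w u β) (hl : l ∈ Ioo (0 : ℝ) 1)
    (hw : ∀ i, w i ∈ Icc (0 : ℝ) 1) (i : V) :
    |β i - G.average r β| ≤ max (G.average r w) (1 - G.average r w) := by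
  obtain ⟨hl0, hl1⟩ := hl
  obtain ⟨hM0, hM1⟩ := G.average_mem_Icc r hw
  set M := G.average r w with hM
  set b := G.average r β with hb
  obtain ⟨c, hc⟩ : ∃ c, c = M + b := ⟨_, rfl⟩
  have key : ∀ j, (1 - l) * u j = w j + l * (β j - c) := fun j => by rw [hc]; exact h.apply j
  have hmax : 0 ≤ max M (1 - M) := le_max_of_le_left hM0
  -- A shift `c` outside `[0, 1]` pushes every vertex the same way, which equal averages forbid
  -- unless `u = w`. Then `β = c - u`, and the sign conditions leave only `u ≡ 1` (for `c < 0`) or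
  -- `u ≡ 0` (for `c > 1`), where `β` is constant.
  rcases lt_or_ge c 0 with hc0 | hc0
  · have hwu : ∀ j, w j ≤ u j := fun j => by
      have := key j
      rcases h.cases j with ⟨h1, h2⟩ | ⟨h1, h2, h3⟩ | ⟨h1, h2⟩
      · rw [h1] at this ⊢
        nlinarith [(hw j).1]
      · rw [h3] at this
        nlinarith
      · rw [h1]
        exact (hw j).2
    have heq := G.eq_of_le_of_average_eq r hwu h.average_eq.symm
    have hconst : ∀ j, β j = c - 1 := fun j => by
      have := key j
      rw [heq] at this
      have h4 : l * (β j - c + u j) = 0 := by linarith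
      have h5 := (mul_eq_zero.mp h4).resolve_left hl0.ne'
      rcases h.cases j with ⟨h1, h2⟩ | ⟨h1, h2, h3⟩ | ⟨h1, h2⟩ <;> linarith
    rw [hb, ← h.eq_average_of_forall_eq hconst i, sub_self, abs_zero]
    exact hmax
  rcases lt_or_ge 1 c with hc1 | hc1
  · have huw : ∀ j, u j ≤ w j := fun j => by
      have := key j
      rcases h.cases j with ⟨h1, h2⟩ | ⟨h1, h2, h3⟩ | ⟨h1, h2⟩
      · rw [h1]
        exact (hw j).1
      · rw [h3] at this
        nlinarith
      · rw [h1] at this ⊢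
        nlinarith [(hw j).2]
    have heq := G.eq_of_le_of_average_eq r huw h.average_eq
    have hconst : ∀ j, β j = c := fun j => by
      have := key j
      rw [← heq] at this
      have h4 : l * (β j - c + u j) = 0 := by linarith
      have h5 := (mul_eq_zero.mp h4).resolve_left hl0.ne'
      rcases h.cases j with ⟨h1, h2⟩ | ⟨h1, h2, h3⟩ | ⟨h1, h2⟩ <;> linarith
    rw [hb, ← h.eq_average_of_forall_eq hconst i, sub_self, abs_zero]
    exact hmax
  -- Now `b = c - M` with `0 ≤ c ≤ 1`. The multiplier lies in `[0, c]` where `u = 0`, vanishes in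
  -- the interior, and lies in `[c - 1, 0]` where `u = 1`; so `β - b` lies in `[M - 1, M]`.
  · have hi := key i
    obtain ⟨hw0, hw1⟩ := hw i
    have hm1 := le_max_left M (1 - M)
    have hm2 := le_max_right M (1 - M)
    rw [abs_le]
    rcases h.cases i with ⟨h1, h2⟩ | ⟨h1, h2, h3⟩ | ⟨h1, h2⟩
    · rw [h1] at hi
      have : β i ≤ c := by
        by_contra! hlt
        nlinarith [mul_pos hl0 (sub_pos.mpr hlt)]
      constructor <;> linarith
    · constructor <;> linarith
    · rw [h1] at hi
      have : c - 1 ≤ β i := by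
        by_contra! hlt
        nlinarith [mul_pos hl0 (sub_pos.mpr hlt)]
      constructor <;> linarith

end Step

theorem exists_isStep {l : ℝ} (hl : l ∈ Ioo (0 : ℝ) 1) {w : V → ℝ}
    (hw : ∀ i, w i ∈ Icc (0 : ℝ) 1) : ∃ u β, G.IsStep r l w u β := by
  obtain ⟨hl0, hl1⟩ := hl
  have hl1' : 0 < 1 - l := sub_pos.mpr hl1
  -- For a prescribed shift `c` the vertexwise obstacle problem is solved by clipping to `[0, 1]`.
  -- At `c = 0` this raises `w` and at `c = 1` it lowers it, so some `c` in between restores the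
  -- average.
  let U : ℝ → V → ℝ := fun c i => max 0 (min 1 ((w i - l * c) / (1 - l)))
  have hU : Continuous fun c => G.average r (U c) := by
    refine (G.continuous_average r).comp (continuous_pi fun i => ?_)
    fun_prop
  have h0 : G.average r w ≤ G.average r (U 0) := G.average_mono r fun i => by
    refine le_max_of_le_right (le_min (hw i).2 ?_)
    rw [le_div_iff₀ hl1']
    nlinarith [(hw i).1]
  have h1 : G.average r (U 1) ≤ G.average r w := G.average_mono r fun i => by
    refine max_le (hw i).1 (min_le_of_right_le ?_)
    rw [div_le_iff₀ hl1']
    nlinarith [(hw i).2]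
  obtain ⟨c, -, hc⟩ := intermediate_value_Icc' zero_le_one hU.continuousOn ⟨h1, h0⟩
  -- Solved from the vertexwise equation with shift `c`. Its average is then `c - avg w`, so the
  -- shift is consistent with the one in the scheme.
  let β : V → ℝ := l⁻¹ • ((1 - l) • U c - w) + c • (1 : V → ℝ)
  have hβ : ∀ i, l * β i = (1 - l) * U c i - (w i - l * c) := fun i => by
    simp only [β, Pi.add_apply, Pi.sub_apply, Pi.smul_apply, smul_eq_mul, Pi.one_apply]
    field_simp
    ring
  have hβavg : l * G.average r β = l * c - l * G.average r w := by
    simp only [β, average_add, average_sub, average_smul, average_one]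
    simp only at hc
    rw [hc]
    field_simp
    ring
  refine ⟨U c, β, fun i => ⟨⟨le_max_left _ _, max_le zero_le_one (min_le_left _ _)⟩, ?_, ?_, ?_⟩, ?_⟩
  · intro h
    have h2 : (w i - l * c) / (1 - l) ≤ 0 := by
      by_contra! h3
      exact absurd h (lt_max_of_lt_right (lt_min one_pos h3)).ne'
    rw [div_le_iff₀ hl1'] at h2
    refine nonneg_of_mul_nonneg_right (a := l) ?_ hl0
    rw [hβ, h]
    linarith
  · intro h3 h4
    have h5 : min 1 ((w i - l * c) / (1 - l)) = U c i :=
      (max_eq_right_of_lt ((lt_max_iff.mp h3).resolve_left (lt_irrefl _))).symm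
    have h6 : (w i - l * c) / (1 - l) = U c i := by
      rcases min_choice 1 ((w i - l * c) / (1 - l)) with h | h <;> linarith
    have h7 := hβ i
    rw [← h6, mul_div_cancel₀ _ hl1'.ne', sub_self] at h7
    exact (mul_eq_zero.mp h7).resolve_left hl0.ne'
  · intro h
    have h2 : 1 ≤ (w i - l * c) / (1 - l) := by
      by_contra! h3
      exact absurd h (max_lt one_pos (min_lt_of_right_lt h3)).ne
    rw [le_div_iff₀ hl1'] at h2
    refine nonpos_of_mul_nonpos_right (a := l) ?_ hl0
    rw [hβ, h]
    linarith
  · ext i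
    have h7 := hβ i
    simp only [Pi.add_apply, Pi.sub_apply, Pi.smul_apply, smul_eq_mul, Pi.one_apply]
    simp only at hc
    rw [hβavg, hc, h7]
    ring

variable {G r}

theorem div_mem_Ioo {ε τ : ℝ} (hτ : 0 < τ) (hτε : τ < ε) : τ / ε ∈ Ioo (0 : ℝ) 1 :=
  ⟨div_pos hτ (hτ.trans hτε), (div_lt_one (hτ.trans hτε)).mpr hτε⟩

variable {ε τ : ℝ} {u₀ : V → ℝ} {u β : ℕ → V → ℝ}

theorem exists_isSemiDiscrete (hτ : 0 < τ) (hτε : τ < ε) (hu₀ : ∀ i, u₀ i ∈ Icc (0 : ℝ) 1) :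
    ∃ u β : ℕ → V → ℝ, G.IsSemiDiscrete r ε τ u₀ u β := by
  have h : ∀ v : V → ℝ, (∀ i, v i ∈ Icc (0 : ℝ) 1) →
      ∃ u β, G.IsStep r (τ / ε) (G.diffusion r τ v) u β := fun v hv =>
    G.exists_isStep r (div_mem_Ioo hτ hτε) fun i => G.diffusion_mem_Icc r hτ.le hv i
  choose! f g hfg using h
  have hu : ∀ m i, (f^[m] u₀) i ∈ Icc (0 : ℝ) 1 := fun m => by
    induction m with
    | zero => exact hu₀
    | succ m ih =>
      rw [Function.iterate_succ_apply']
      exact (hfg _ ih).mem_Icc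
  -- The truncated `m - 1` matters only at `m = 0`, where the multiplier is irrelevant.
  refine ⟨fun m => f^[m] u₀, fun m => g (f^[m - 1] u₀), rfl, fun m => ?_⟩
  simp only [Function.iterate_succ_apply', Nat.add_sub_cancel]
  exact ⟨(hfg _ (hu m)).mem, (hfg _ (hu m)).eq⟩

theorem IsSemiDiscrete.isStep (h : G.IsSemiDiscrete r ε τ u₀ u β) (m : ℕ) :
    G.IsStep r (τ / ε) (G.diffusion r τ (u m)) (u (m + 1)) (β (m + 1)) :=
  ⟨(h.2 m).1, (h.2 m).2⟩

theorem IsSemiDiscrete.mem_Icc (h : G.IsSemiDiscrete r ε τ u₀ u β)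
    (hu₀ : ∀ i, u₀ i ∈ Icc (0 : ℝ) 1) (m : ℕ) (i : V) : u m i ∈ Icc (0 : ℝ) 1 := by
  cases m with
  | zero => rw [h.1]; exact hu₀ i
  | succ m => exact (h.isStep m).mem_Icc i

theorem IsSemiDiscrete.average_eq (h : G.IsSemiDiscrete r ε τ u₀ u β) (m : ℕ) :
    G.average r (u m) = G.average r u₀ := by
  induction m with
  | zero => rw [h.1]
  | succ m ih => rw [(h.isStep m).average_eq, average_diffusion, ih]

end WeightedGraph

/-! ### Speed of the discrete trajectories. -/

namespace WeightedGraph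

variable {V : Type*} [Fintype V] (G : WeightedGraph V) (r ε : ℝ) (u₀ : V → ℝ)

/-- The infinitesimal Lipschitz constant of the limiting trajectory. -/
noncomputable def speedBound : ℝ :=
  max (G.average r u₀) (1 - G.average r u₀) * G.normV r 1 *
    (max (1 / ε) (G.opNorm r (G.laplacian r) - 1 / ε) + 1 / ε)

/-- A bound for the speed of the scheme with time step `τ`. -/
noncomputable def discreteSpeedBound (τ : ℝ) : ℝ :=
  (G.speedBound r ε u₀
    + G.normV r 1 * (‖τ‖⁻¹ * ‖G.diffusion r τ - 1 + τ • G.laplacian r‖)) / (1 - τ / ε)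

variable {ε} in
theorem speedBound_nonneg (hε : 0 < ε) (hu₀ : ∀ i, u₀ i ∈ Icc (0 : ℝ) 1) :
    0 ≤ G.speedBound r ε u₀ := by
  have h1 : 0 ≤ 1 / ε := by positivity
  exact mul_nonneg (mul_nonneg (le_max_of_le_left (G.average_mem_Icc r hu₀).1)
    (G.normV_nonneg r 1)) (add_nonneg (le_max_of_le_left h1) h1)

variable {ε} in
-- The exponentials are pure slack: `1/ε ≤ e^{1/ε} - 1` and `1 ≤ e^{1/ε}`.
theorem speedBound_le_lipschitzConstant (hε : 0 < ε) (hu₀ : ∀ i, u₀ i ∈ Icc (0 : ℝ) 1) :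
    G.speedBound r ε u₀ ≤ G.lipschitzConstant r ε u₀ := by
  have h1 : 0 ≤ 1 / ε := by positivity
  refine mul_le_mul_of_nonneg_left ?_ (mul_nonneg
    (le_max_of_le_left (G.average_mem_Icc r hu₀).1) (G.normV_nonneg r 1))
  refine add_le_add (max_le_max_right _ ?_) (le_mul_of_one_le_right h1 (Real.one_le_exp h1))
  linarith [Real.add_one_le_exp (1 / ε)]

theorem tendsto_discreteSpeedBound :
    Tendsto (G.discreteSpeedBound r ε u₀) (𝓝 0) (𝓝 (G.speedBound r ε u₀)) := by
  have h1 : Tendsto (fun τ : ℝ => ‖τ‖⁻¹ * ‖G.diffusion r τ - 1 + τ • G.laplacian r‖)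
      (𝓝 0) (𝓝 0) := by
    -- The claim is exactly the differentiability of `τ ↦ e^{-τΔ}` at `0`, with derivative `-Δ`.
    have := hasDerivAt_iff_tendsto.mp (hasDerivAt_exp_smul_const (𝕂 := ℝ) (-G.laplacian r) (0 : ℝ))
    refine this.congr fun τ => ?_
    have hneg : (-τ) • G.laplacian r = τ • -G.laplacian r := by
      ext u i
      simp
    rw [diffusion, hneg]
    simp
  have h2 : Tendsto (fun τ : ℝ => 1 - τ / ε) (𝓝 0) (𝓝 1) := by
    have : Continuous fun τ : ℝ => 1 - τ / ε := by fun_prop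
    simpa using this.tendsto 0
  have h3 := ((h1.const_mul (G.normV r 1)).const_add (G.speedBound r ε u₀)).div h2 one_ne_zero
  rw [mul_zero, add_zero, div_one] at h3
  exact h3

variable {G r ε u₀} {τ : ℝ} {u β : ℕ → V → ℝ}

theorem discreteSpeedBound_nonneg (hτ : 0 < τ) (hτε : τ < ε) (hu₀ : ∀ i, u₀ i ∈ Icc (0 : ℝ) 1) :
    0 ≤ G.discreteSpeedBound r ε u₀ τ :=
  div_nonneg (add_nonneg (G.speedBound_nonneg r u₀ (hτ.trans hτε) hu₀)
    (mul_nonneg (G.normV_nonneg r 1) (by positivity)))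
    (sub_nonneg.mpr (div_mem_Ioo hτ hτε).2.le)

theorem IsSemiDiscrete.normV_succ_sub_le (h : G.IsSemiDiscrete r ε τ u₀ u β) (hτ : 0 < τ)
    (hτε : τ < ε) (hu₀ : ∀ i, u₀ i ∈ Icc (0 : ℝ) 1) (m : ℕ) :
    G.normV r (u (m + 1) - u m) ≤ G.discreteSpeedBound r ε u₀ τ * τ := by
  have hε := hτ.trans hτε
  have hl := div_mem_Ioo hτ hτε
  have hu := h.mem_Icc hu₀
  obtain ⟨hM0, hM1⟩ := G.average_mem_Icc r hu₀
  have havg : G.average r (G.diffusion r τ (u m)) = G.average r u₀ := by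
    rw [average_diffusion, h.average_eq]
  have hβ := (h.isStep m).abs_sub_average_le hl fun i => G.diffusion_mem_Icc r hτ.le (hu m) i
  have happ := (h.isStep m).apply
  rw [havg] at hβ happ
  set M := G.average r u₀ with hM
  set b := G.average r (β (m + 1))
  have hmax : 0 ≤ max M (1 - M) := le_max_of_le_left hM0
  let R := G.diffusion r τ - 1 + τ • G.laplacian r
  let v := u m - M • (1 : V → ℝ)
  let d := β (m + 1) - b • (1 : V → ℝ)
  have hv : G.normV r v ≤ max M (1 - M) * G.normV r 1 :=
    G.normV_le_of_forall_abs_le r hmax fun i => by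
      have h1 := le_max_left M (1 - M)
      have h2 := le_max_right M (1 - M)
      obtain ⟨h3, h4⟩ := hu m i
      simp only [v, Pi.sub_apply, Pi.smul_apply, smul_eq_mul, Pi.one_apply, mul_one, abs_le]
      constructor <;> linarith
  have hd : G.normV r d ≤ max M (1 - M) * G.normV r 1 :=
    G.normV_le_of_forall_abs_le r hmax fun i => by simpa [d] using hβ i
  have hR : G.normV r (R (u m)) ≤ ‖R‖ * G.normV r 1 := by
    refine (G.normV_le_norm r _).trans (mul_le_mul_of_nonneg_right ?_ (G.normV_nonneg r 1))
    refine R.le_of_opNorm_le_of_le le_rfl ?_ |>.trans_eq (mul_one _)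
    refine (pi_norm_le_iff_of_nonneg zero_le_one).mpr fun i => ?_
    rw [Real.norm_eq_abs, abs_of_nonneg (hu m i).1]
    exact (hu m i).2
  have hΔ : G.normV r ((1 / ε) • v - G.laplacian r v)
      ≤ max (1 / ε) (G.opNorm r (G.laplacian r) - 1 / ε) * (max M (1 - M) * G.normV r 1) :=
    (G.normV_smul_sub_laplacian_le r (by positivity) v).trans
      (mul_le_mul_of_nonneg_left hv (le_max_of_le_left (by positivity)))
  -- The average `M` can be subtracted inside the Laplacian because `Δ` annihilates constants; this
  -- puts the small vector `v` in place of `u m`.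
  have hstep : (1 - τ / ε) • (u (m + 1) - u m)
      = R (u m) + τ • ((1 / ε) • v - G.laplacian r v) + (τ / ε) • d := by
    have hΔv : G.laplacian r v = G.laplacian r (u m) := by simp [v, laplacian_one]
    rw [hΔv]
    ext i
    have := happ i
    simp [R, v, d] at this ⊢
    linear_combination this
  have hnorm := G.normV_smul r (1 - τ / ε) (u (m + 1) - u m)
  rw [hstep, abs_of_pos (sub_pos.mpr hl.2)] at hnorm
  have htri := (G.normV_add_le r (R (u m) + τ • ((1 / ε) • v - G.laplacian r v))
    ((τ / ε) • d)).trans (add_le_add_left (G.normV_add_le r _ _) _)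
  rw [hnorm, normV_smul, normV_smul, abs_of_pos hτ, abs_of_pos hl.1] at htri
  rw [discreteSpeedBound, div_mul_eq_mul_div, le_div_iff₀ (sub_pos.mpr hl.2), mul_comm]
  refine htri.trans ((add_le_add (add_le_add hR (mul_le_mul_of_nonneg_left hΔ hτ.le))
    (mul_le_mul_of_nonneg_left hd hl.1.le)).trans_eq ?_)
  rw [speedBound, ← hM, Real.norm_of_nonneg hτ.le]
  field_simp
  ring

theorem IsSemiDiscrete.normV_sub_le (h : G.IsSemiDiscrete r ε τ u₀ u β) (hτ : 0 < τ)
    (hτε : τ < ε) (hu₀ : ∀ i, u₀ i ∈ Icc (0 : ℝ) 1) (m k : ℕ) :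
    G.normV r (u (m + k) - u m) ≤ G.discreteSpeedBound r ε u₀ τ * (τ * k) := by
  induction k with
  | zero => simp [normV_zero]
  | succ k ih =>
    rw [← sub_add_sub_cancel (u (m + (k + 1))) (u (m + k))]
    refine (G.normV_add_le r _ _).trans
      ((add_le_add (h.normV_succ_sub_le hτ hτε hu₀ (m + k)) ih).trans_eq ?_)
    push_cast
    ring

/-- Rounding up both times costs at most one extra step, hence the additive `τ`, which disappears in
the limit. -/
theorem IsSemiDiscrete.normV_ceil_sub_ceil_le (h : G.IsSemiDiscrete r ε τ u₀ u β) (hτ : 0 < τ)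
    (hτε : τ < ε) (hu₀ : ∀ i, u₀ i ∈ Icc (0 : ℝ) 1) {s t : ℝ} (hs : 0 ≤ s) (ht : 0 ≤ t) :
    G.normV r (u ⌈t / τ⌉₊ - u ⌈s / τ⌉₊) ≤ G.discreteSpeedBound r ε u₀ τ * (|t - s| + τ) := by
  wlog hst : s ≤ t generalizing s t
  · rw [normV_sub_comm, abs_sub_comm]
    exact this ht hs (le_of_not_ge hst)
  obtain ⟨k, hk⟩ := Nat.exists_eq_add_of_le
    (Nat.ceil_mono (div_le_div_of_nonneg_right hst hτ.le))
  rw [hk]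
  refine (h.normV_sub_le hτ hτε hu₀ _ k).trans
    (mul_le_mul_of_nonneg_left ?_ (discreteSpeedBound_nonneg hτ hτε hu₀))
  have h1 := Nat.ceil_lt_add_one (div_nonneg ht hτ.le)
  have h2 := Nat.le_ceil (s / τ)
  rw [hk, Nat.cast_add] at h1
  have h3 : (k : ℝ) ≤ (t - s) / τ + 1 := by rw [sub_div]; linarith
  rw [abs_of_nonneg (sub_nonneg.mpr hst)]
  calc τ * k ≤ τ * ((t - s) / τ + 1) := mul_le_mul_of_nonneg_left h3 hτ.le
    _ = t - s + τ := by field_simp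

/-! ### Passage to the limit and compactness. -/

theorem IsSemiDiscreteLimit.normV_sub_le {τ : ℕ → ℝ} {uhat : ℝ → V → ℝ} (hε : 0 < ε)
    (hu₀ : ∀ i, u₀ i ∈ Icc (0 : ℝ) 1) (h : G.IsSemiDiscreteLimit r ε u₀ τ uhat)
    {s t : ℝ} (hs : 0 ≤ s) (ht : 0 ≤ t) :
    G.normV r (uhat t - uhat s) ≤ G.lipschitzConstant r ε u₀ * |t - s| := by
  obtain ⟨hτ, hτ0, u, β, hu, hlim⟩ := h
  have h1 := ((G.continuous_normV r).tendsto _).comp ((hlim t ht).sub (hlim s hs))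
  have h2 := ((G.tendsto_discreteSpeedBound r ε u₀).comp hτ0).mul (hτ0.const_add |t - s|)
  rw [add_zero] at h2
  refine (le_of_tendsto_of_tendsto' h1 h2 fun n =>
    (hu n).normV_ceil_sub_ceil_le (hτ n).1 (hτ n).2 hu₀ hs ht).trans ?_
  exact mul_le_mul_of_nonneg_right (G.speedBound_le_lipschitzConstant r u₀ hε hu₀) (abs_nonneg _)

theorem IsSemiDiscreteLimit.mem_Icc {τ : ℕ → ℝ} {uhat : ℝ → V → ℝ}
    (hu₀ : ∀ i, u₀ i ∈ Icc (0 : ℝ) 1) (h : G.IsSemiDiscreteLimit r ε u₀ τ uhat)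
    {t : ℝ} (ht : 0 ≤ t) (i : V) : uhat t i ∈ Icc (0 : ℝ) 1 := by
  obtain ⟨-, -, u, β, hu, hlim⟩ := h
  exact isClosed_Icc.mem_of_tendsto (tendsto_pi_nhds.mp (hlim t ht) i)
    (Eventually.of_forall fun n => (hu n).mem_Icc hu₀ _ i)

theorem IsSemiDiscreteLimit.normV_sub_le_normV_one {τ : ℕ → ℝ} {uhat : ℝ → V → ℝ}
    (hu₀ : ∀ i, u₀ i ∈ Icc (0 : ℝ) 1) (h : G.IsSemiDiscreteLimit r ε u₀ τ uhat)
    {s t : ℝ} (hs : 0 ≤ s) (ht : 0 ≤ t) : G.normV r (uhat t - uhat s) ≤ G.normV r 1 := by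
  refine G.normV_le_of_abs_le r fun i => ?_
  obtain ⟨h1, h2⟩ := h.mem_Icc hu₀ hs i
  obtain ⟨h3, h4⟩ := h.mem_Icc hu₀ ht i
  rw [Pi.one_apply, abs_one, Pi.sub_apply, abs_le]
  constructor <;> linarith

/-- Arzelà–Ascoli for piecewise constant interpolations: a sequence of `[0, 1]`-valued functions
that is asymptotically equi-Lipschitz on `[0, ∞)` has a pointwise convergent subsequence. -/
theorem exists_subseq_tendsto_of_lipschitz {W : ℕ → ℝ → V → ℝ} {C : ℝ} {δ : ℕ → ℝ}
    (hW : ∀ n t i, W n t i ∈ Icc (0 : ℝ) 1) (hδ : Tendsto δ atTop (𝓝 0))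
    (hlip : ∀ n s t, 0 ≤ s → 0 ≤ t → ‖W n t - W n s‖ ≤ C * |t - s| + δ n) :
    ∃ φ : ℕ → ℕ, StrictMono φ ∧ ∃ w : ℝ → V → ℝ, ∀ t, 0 ≤ t →
      Tendsto (fun n => W (φ n) t) atTop (𝓝 (w t)) := by
  have hK : IsCompact (Set.pi univ fun _ : ℚ => Set.pi univ fun _ : V => Icc (0 : ℝ) 1) :=
    isCompact_univ_pi fun _ => isCompact_univ_pi fun _ => isCompact_Icc
  -- Tychonoff over the countable index set `ℚ` replaces the diagonal argument: the product is
  -- compact and metrizable, so one subsequence converges at all rational times.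
  obtain ⟨a, -, φ, hφ, ha⟩ := hK.tendsto_subseq (x := fun n (q : ℚ) => W n q)
    fun n q _ i _ => hW n q i
  have hconv : ∀ t, 0 ≤ t → ∃ l, Tendsto (fun n => W (φ n) t) atTop (𝓝 l) := fun t ht => by
    refine cauchySeq_tendsto_of_complete (Metric.cauchySeq_iff'.mpr fun η hη => ?_)
    have hC : 0 < |C| + 1 := by positivity
    -- A rational to the right of `t` stays in `[0, ∞)`, where the Lipschitz bound applies. Each
    -- comparison between `t` and `q` costs less than `η/8 + η/8` and the Cauchy property at `q`
    -- costs `η/4`, so the total is below `η`.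
    obtain ⟨q, hq1, hq2⟩ := exists_rat_btwn (show t < t + η / (8 * (|C| + 1)) by
      linarith [show 0 < η / (8 * (|C| + 1)) by positivity])
    have hCq : C * |t - q| ≤ η / 8 := by
      rw [abs_sub_comm, abs_of_pos (sub_pos.mpr hq1)]
      calc C * (q - t) ≤ (|C| + 1) * (η / (8 * (|C| + 1))) :=
            mul_le_mul (by linarith [le_abs_self C]) (by linarith) (by linarith) hC.le
        _ = η / 8 := by field_simp
    have hcq : CauchySeq fun n => W (φ n) q := (tendsto_pi_nhds.mp ha q).cauchySeq
    obtain ⟨N, hN⟩ := Metric.cauchySeq_iff.mp hcq (η / 4) (by positivity)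
    obtain ⟨N', hN'⟩ := eventually_atTop.mp
      ((hδ.comp hφ.tendsto_atTop).eventually_lt_const (show 0 < η / 8 by positivity))
    refine ⟨max N N', fun n hn => ?_⟩
    have h1 := hlip (φ n) q t (ht.trans hq1.le) ht
    have h2 := hlip (φ (max N N')) q t (ht.trans hq1.le) ht
    have h3 := hN n (le_of_max_le_left hn) (max N N') (le_max_left _ _)
    have h4 : δ (φ n) < η / 8 := hN' n (le_of_max_le_right hn)
    have h5 : δ (φ (max N N')) < η / 8 := hN' _ (le_max_right _ _)
    rw [← dist_eq_norm] at h1 h2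
    have h6 := dist_triangle4_right (W (φ n) t) (W (φ (max N N')) t) (W (φ n) q)
      (W (φ (max N N')) q)
    linarith
  choose! w hw using hconv
  exact ⟨φ, hφ, w, hw⟩

theorem exists_subseq_isSemiDiscreteLimit (hε : 0 < ε) (hu₀ : ∀ i, u₀ i ∈ Icc (0 : ℝ) 1)
    {τ : ℕ → ℝ} (hτ : ∀ n, 0 < τ n) (hτ0 : Tendsto τ atTop (𝓝 0)) :
    ∃ φ : ℕ → ℕ, StrictMono φ ∧
      ∃ uhat : ℝ → V → ℝ, G.IsSemiDiscreteLimit r ε u₀ (τ ∘ φ) uhat := by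
  obtain ⟨B, hB⟩ := G.norm_le_normV r
  set K := G.speedBound r ε u₀ + 1
  -- The first `N` time steps are dropped so that `τ < ε`, which makes the scheme solvable, and the
  -- speeds are uniformly bounded by `K`.
  obtain ⟨N, hN⟩ := eventually_atTop.mp ((hτ0.eventually_lt_const hε).and
    (((G.tendsto_discreteSpeedBound r ε u₀).comp hτ0).eventually_le_const
      (show G.speedBound r ε u₀ < K from lt_add_one _)))
  have hτε : ∀ n, τ (n + N) < ε := fun n => (hN _ (Nat.le_add_left N n)).1
  have hK : ∀ n, G.discreteSpeedBound r ε u₀ (τ (n + N)) ≤ K :=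
    fun n => (hN _ (Nat.le_add_left N n)).2
  have hτN : Tendsto (fun n => τ (n + N)) atTop (𝓝 0) := (tendsto_add_atTop_iff_nat N).mpr hτ0
  choose u β hu using fun n =>
    exists_isSemiDiscrete (G := G) (r := r) (hτ (n + N)) (hτε n) hu₀
  obtain ⟨φ, hφ, w, hw⟩ := exists_subseq_tendsto_of_lipschitz
    (W := fun n t => u n ⌈t / τ (n + N)⌉₊) (C := |B| * K) (δ := fun n => |B| * K * τ (n + N))
    (fun n t i => (hu n).mem_Icc hu₀ _ i) (by simpa using hτN.const_mul (|B| * K))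
    fun n s t hs ht => by
      have h1 := (hu n).normV_ceil_sub_ceil_le (hτ (n + N)) (hτε n) hu₀ hs ht
      have h2 := mul_le_mul_of_nonneg_right (hK n)
        (add_nonneg (abs_nonneg (t - s)) (hτ (n + N)).le)
      calc _ ≤ |B| * G.normV r (u n ⌈t / τ (n + N)⌉₊ - u n ⌈s / τ (n + N)⌉₊) :=
            (hB _).trans (mul_le_mul_of_nonneg_right (le_abs_self B) (G.normV_nonneg r _))
        _ ≤ |B| * (K * (|t - s| + τ (n + N))) :=
            mul_le_mul_of_nonneg_left (h1.trans h2) (abs_nonneg B)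
        _ = _ := by ring
  exact ⟨fun n => φ n + N, hφ.add_const N, w, fun n => ⟨hτ _, hτε _⟩,
    hτN.comp hφ.tendsto_atTop, fun n => u (φ n), fun n => β (φ n), fun n => hu (φ n), hw⟩

end WeightedGraph

theorem mainTheorem12 {V : Type*} [Fintype V] (G : WeightedGraph V) (r : ℝ)
    (hr : r ∈ Set.Icc (0 : ℝ) 1) (ε : ℝ) (hε : 0 < ε) (u₀ : V → ℝ)
    (hu₀ : ∀ i, u₀ i ∈ Set.Icc (0 : ℝ) 1) :
    -- the semi-discrete limit exists along a subsequence of any sequence of time steps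
    (∀ τ : ℕ → ℝ, (∀ n, 0 < τ n) → Filter.Tendsto τ Filter.atTop (nhds 0) →
      ∃ φ : ℕ → ℕ, StrictMono φ ∧
        ∃ uhat : ℝ → V → ℝ, G.IsSemiDiscreteLimit r ε u₀ (τ ∘ φ) uhat) ∧
    -- every semi-discrete limit is Lipschitz continuous on `[0, ∞)`, with explicit constants
    (∀ (τ : ℕ → ℝ) (uhat : ℝ → V → ℝ), G.IsSemiDiscreteLimit r ε u₀ τ uhat →
      ∀ s t : ℝ, 0 ≤ s → 0 ≤ t →
        G.normV r (uhat t - uhat s) ≤ G.lipschitzConstant r ε u₀ * |t - s| ∧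
        (1 ≤ |t - s| → G.normV r (uhat t - uhat s) ≤ G.normV r 1 * |t - s|)) := by
  refine ⟨fun τ hτ hτ0 => WeightedGraph.exists_subseq_isSemiDiscreteLimit hε hu₀ hτ hτ0,
    fun τ uhat h s t hs ht => ⟨h.normV_sub_le hε hu₀ hs ht, fun hst => ?_⟩⟩
  exact (h.normV_sub_le_normV_one hu₀ hs ht).trans
    (le_mul_of_one_le_right (G.normV_nonneg r 1) hst)
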